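/- Let $0\le\tau<1$, and let $$V(z)=\frac{(\operatorname{Re}z)^2}{1+\tau}+\frac{(\operatorname{Im}z)^2}{1-\tau},\qquad \mathcal E_\tau=\left\{z\in\mathbb C:\left(\frac{\operatorname{Re}z}{1+\tau}\right)^2+\left(\frac{\operatorname{Im}z}{1-\tau}\right)^2\le 1\right\}$$ be the elliptic Ginibre potential and its droplet. Let $$\psi(z)=\tfrac12\left(z+\sqrt{z^2-4\tau}\right),$$ where $\sqrt{z^2-4\tau}$ is the branch that is analytic on $\mathbb C\setminus[-2\sqrt\tau,2\sqrt\tau]$ and positive for large positive $z$. Then $\psi$ is a conformal map (a holomorphic bijection) from $\mathbb C\setminus\mathcal E_\tau$ onto $\{w\in\mathbb C:|w|>1\}$. The obstacle function $\check V$ of $V$, that is, the pointwise largest subharmonic function $u:\mathbb C\to[-\infty,\infty)$ that satisfies both $u\le V$ on $\mathbb C$ and $u(z)=\log|z|^2+\mathcal O(1)$ as $|z|\to\infty$, exists and is given by $$\check V(z)=\begin{cases}V(z), & z\in\mathcal E_\tau,\\[2mm] \displaystyle 2\log|\psi(z)|+1+\tau\operatorname{Re}\frac1{\psi(z)^2},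 & z\in\mathbb C\setminus\mathcal E_\tau.\end{cases}$$ -/

import Mathlib

noncomputable section

namespace EllipticGinibre

/-- `u : ℂ → [-∞, ∞)` is subharmonic on `ℂ`: it is upper semicontinuous, never `+∞`, and on every
closed disc it lies below each continuous function that is harmonic inside and dominates `u` on the
bounding circle. -/
structure IsSubharmonic (u : ℂ → EReal) : Prop where
  lt_top : ∀ z, u z < ⊤
  upperSemicontinuous : UpperSemicontinuous u
  le_of_harmonic : ∀ (c : ℂ) (r : ℝ), 0 < r → ∀ h : ℂ → ℝ,
    ContinuousOn h (Metric.closedBall c r) →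
    InnerProductSpace.HarmonicOnNhd h (Metric.ball c r) →
    (∀ z ∈ Metric.sphere c r, u z ≤ (h z : EReal)) →
    ∀ z ∈ Metric.closedBall c r, u z ≤ (h z : EReal)

/-- `u z = log (|z| ^ 2) + O(1)` as `|z| → ∞`. -/
def HasLogSqGrowth (u : ℂ → EReal) : Prop :=
  ∃ C R : ℝ, ∀ z : ℂ, R ≤ ‖z‖ →
    ((Real.log (‖z‖ ^ 2) - C : ℝ) : EReal) ≤ u z ∧ u z ≤ ((Real.log (‖z‖ ^ 2) + C : ℝ) : EReal)

/-- The competitors in the obstacle problem with obstacle `Q`. -/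
def obstacleClass (Q : ℂ → ℝ) : Set (ℂ → EReal) :=
  {u | IsSubharmonic u ∧ (∀ z, u z ≤ (Q z : EReal)) ∧ HasLogSqGrowth u}

/-- `u` is the obstacle function of `Q`: the (pointwise) largest subharmonic function with `u ≤ Q`
and `u z = log (|z| ^ 2) + O(1)` at infinity. -/
def IsObstacleFunction (Q : ℂ → ℝ) (u : ℂ → ℝ) : Prop :=
  IsGreatest (obstacleClass Q) (fun z => (u z : EReal))

/-- The elliptic Ginibre potential. -/
def potential (τ : ℝ) (z : ℂ) : ℝ := z.re ^ 2 / (1 + τ) + z.im ^ 2 / (1 - τ)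

/-- The closed ellipse with half-axes `1 + τ` and `1 - τ`. -/
def ellipse (τ : ℝ) : Set ℂ := {z | (z.re / (1 + τ)) ^ 2 + (z.im / (1 - τ)) ^ 2 ≤ 1}

/-- The cut `[-2√τ, 2√τ]` of the square root below. -/
def cut (τ : ℝ) : Set ℂ := {z | z.im = 0 ∧ |z.re| ≤ 2 * Real.sqrt τ}

/-- The branch of `√(z ^ 2 - 4 τ)` on `ℂ \ [-2√τ, 2√τ]` that is positive for large positive `z`,
written with the principal square root, whose argument `1 - 4 τ / z ^ 2` meets `(-∞, 0]`
for `z ≠ 0` exactly when `z` is in the cut. -/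
def sqrtBranch (τ : ℝ) (z : ℂ) : ℂ := z * (1 - 4 * (τ : ℂ) / z ^ 2) ^ (1 / 2 : ℂ)

/-- `ψ(z) = (z + √(z ^ 2 - 4 τ)) / 2`. -/
def psi (τ : ℝ) (z : ℂ) : ℂ := (z + sqrtBranch τ z) / 2

open Classical in
/-- The explicit function: the potential on the ellipse, and
`2 log |ψ| + 1 + τ Re (1 / ψ ^ 2)` outside it. -/
def obstacleFormula (τ : ℝ) (z : ℂ) : ℝ :=
  if z ∈ ellipse τ then potential τ z
  else 2 * Real.log ‖psi τ z‖ + 1 + τ * (1 / psi τ z ^ 2).re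

lemma sqrtBranch_sq (τ : ℝ) {z : ℂ} (hz : z ≠ 0) : sqrtBranch τ z ^ 2 = z ^ 2 - 4 * τ := by
  have h : ((1 - 4 * (τ : ℂ) / z ^ 2) ^ (1 / 2 : ℂ)) ^ 2 = 1 - 4 * (τ : ℂ) / z ^ 2 := by
    simp
  rw [sqrtBranch, mul_pow, h]
  field_simp

lemma sqrtBranch_ofReal (τ : ℝ) {x : ℝ} (hx : 0 < x) (hτ : 4 * τ < x ^ 2) :
    sqrtBranch τ x = (x * Real.sqrt (1 - 4 * τ / x ^ 2) : ℝ) ∧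
      0 < x * Real.sqrt (1 - 4 * τ / x ^ 2) := by
  have h1 : 0 < 1 - 4 * τ / x ^ 2 := by
    rw [sub_pos, div_lt_one (by positivity)]; exact hτ
  refine ⟨?_, by positivity⟩
  rw [sqrtBranch, Real.sqrt_eq_rpow]
  push_cast
  rw [Complex.ofReal_cpow h1.le]
  push_cast
  rfl

lemma differentiableOn_sqrtBranch {τ : ℝ} (hτ : 0 ≤ τ) :
    DifferentiableOn ℂ (sqrtBranch τ) (cut τ)ᶜ := by
  intro z hz
  have hz0 : z ≠ 0 := by
    rintro rfl
    exact hz (by simp [cut])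
  have hs : 1 - 4 * (τ : ℂ) / z ^ 2 ∈ Complex.slitPlane := by
    by_contra hn
    rw [Complex.mem_slitPlane_iff, not_or, not_lt, not_not] at hn
    obtain ⟨hre, him⟩ := hn
    set w : ℂ := 1 - 4 * (τ : ℂ) / z ^ 2 with hw
    have hwr : w = (w.re : ℂ) := Complex.ext (by simp) (by simp [him])
    have hz2 : z ^ 2 * (1 - w) = 4 * τ := by rw [hw]; field_simp; ring
    rw [hwr] at hz2
    have e1 := congrArg Complex.re hz2
    have e2 := congrArg Complex.im hz2
    simp [pow_two] at e1 e2
    have h1 : 0 < 1 - w.re := by linarith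
    have h2 : z.re * z.im = 0 := by
      rcases e2 with e2 | e2
      · linarith
      · linarith
    have h3 : z.re * z.re - z.im * z.im ≤ 4 * τ ∧ 0 ≤ z.re * z.re - z.im * z.im := by
      constructor
      · by_contra h4
        push Not at h4
        nlinarith
      · by_contra h4
        push Not at h4
        nlinarith
    have h5 : z.im = 0 := by
      rcases mul_eq_zero.mp h2 with h | h
      · rw [h] at h3
        nlinarith [h3.2]
      · exact h
    apply hz
    refine ⟨h5, abs_le_of_sq_le_sq ?_ (by positivity)⟩
    rw [mul_pow, Real.sq_sqrt hτ]
    rw [h5] at h3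
    nlinarith [h3.1]
  apply DifferentiableAt.differentiableWithinAt
  unfold sqrtBranch
  refine differentiableAt_id.mul (DifferentiableAt.cpow ?_ (differentiableAt_const _) hs)
  refine (differentiableAt_const _).sub ((differentiableAt_const _).div ?_ (pow_ne_zero 2 hz0))
  fun_prop

end EllipticGinibre

end

/-!
The Joukowski map `w ↦ w + τ / w` inverts `ψ`. Since `ψ z` and `z - ψ z` have product `τ` and the
principal square root has nonnegative real part, `ψ z` is the larger of the two roots
(`le_norm_psi_sq`). An explicit factorisation (`ellipseForm_joukowski`) then shows that `z` is
outside the ellipse exactly when `1 < ‖ψ z‖`, which gives the bijection.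

Write `V` for the potential and `U = 2 log ‖ψ‖ + 1 + τ Re (1 / ψ ^ 2)`, which is harmonic off the
cut. In the coordinate `w = ψ z` the gap `V - U` is a convex combination of two functions of
`‖w‖ ^ 2`, nonnegative by two elementary inequalities for the logarithm and zero when `‖w‖ = 1`.
So `U ≤ V` away from `0`, with equality on the boundary of the ellipse.

Both halves of the obstacle problem rest on one maximum principle, `le_of_locallySubharmonicAt`,
for upper semicontinuous functions that are compared with harmonic ones at the centres of small
discs only. It is proved by adding a small multiple of `|z| ^ 2` and looking at a maximum point.

* The explicit function is subharmonic since it has at every point a harmonic minorant touching it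
  there: the tangent plane of the convex function `V` inside the ellipse, and `U` on the boundary
  and outside.
* A competitor is at most `V` on the ellipse by definition. Outside, it is compared with the
  harmonic function `U + ε log ‖ψ‖`: near the ellipse the competitor is at most `V`, which is close
  to `U`, and near infinity `ε log ‖ψ‖` beats the bounded terms. Let `ε` tend to `0`.
-/

open InnerProductSpace Metric Filter Topology Set

namespace EllipticGinibre

/-! ### Locally subharmonic functions and the maximum principle -/

/-- The comparison with harmonic functions that characterises subharmonicity, at the centre of all
sufficiently small discs around `z`. -/
def LocallySubharmonicAt (u : ℂ → EReal) (z : ℂ) : Prop :=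
  ∀ᶠ r : ℝ in 𝓝[>] 0, ∀ h : ℂ → ℝ, HarmonicOnNhd h (closedBall z r) →
    (∀ y ∈ sphere z r, u y ≤ (h y : EReal)) → u z ≤ (h z : EReal)

lemma IsSubharmonic.locallySubharmonicAt {u : ℂ → EReal} (hu : IsSubharmonic u) (z : ℂ) :
    LocallySubharmonicAt u z := by
  filter_upwards [self_mem_nhdsWithin] with r hr h hh hle
  exact hu.le_of_harmonic z r hr h hh.continuousOn (hh.mono ball_subset_closedBall) hle z
    (mem_closedBall_self (le_of_lt hr))

/-- A function with a harmonic minorant near `z` that touches it at `z` is locally subharmonic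
at `z`: the mean value property turns a bound on a circle for the minorant into one at `z`. -/
lemma locallySubharmonicAt_of_minorant {f g : ℂ → ℝ} {z : ℂ} (hg : HarmonicAt g z)
    (hgf : ∀ᶠ y in 𝓝 z, g y ≤ f y) (hz : f z = g z) :
    LocallySubharmonicAt (fun y => (f y : EReal)) z := by
  obtain ⟨ε, hε, hball⟩ := Metric.eventually_nhds_iff_ball.1 (hg.eventually.and hgf)
  filter_upwards [Ioo_mem_nhdsGT hε] with r hr h hh hle
  have hr0 : |r| = r := abs_of_pos hr.1
  have hsub : closedBall z r ⊆ ball z ε := closedBall_subset_ball hr.2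
  have hg' : HarmonicOnNhd g (closedBall z |r|) := fun y hy =>
    (hball y (hsub (by rwa [hr0] at hy))).1
  have hh' : HarmonicOnNhd h (closedBall z |r|) := by rwa [hr0]
  have key : g z ≤ h z := by
    rw [← hg'.circleAverage_eq, ← hh'.circleAverage_eq]
    apply Real.circleAverage_mono
    · exact (hg'.continuousOn.mono sphere_subset_closedBall).circleIntegrable'
    · exact (hh'.continuousOn.mono sphere_subset_closedBall).circleIntegrable'
    · intro y hy
      rw [hr0] at hy
      exact (hball y (hsub (sphere_subset_closedBall hy))).2.trans (EReal.coe_le_coe_iff.1 (hle y hy))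
  exact EReal.coe_le_coe_iff.2 (hz.trans_le key)

/-- The maximum principle: a locally subharmonic function on `Ω` lies below a harmonic function `h`
as soon as each set where it exceeds `h + δ` stays in a compact part of `Ω`. -/
lemma le_of_locallySubharmonicAt {Ω : Set ℂ} (hΩ : IsOpen Ω) {u : ℂ → EReal}
    (htop : ∀ z, u z < ⊤) (husc : UpperSemicontinuous u)
    (hu : ∀ z ∈ Ω, LocallySubharmonicAt u z) {h : ℂ → ℝ} (hh : HarmonicOnNhd h Ω)
    (hK : ∀ δ : ℝ, 0 < δ → ∃ K ⊆ Ω, IsCompact K ∧ ∀ z ∈ Ω, z ∉ K → u z ≤ ((h z + δ : ℝ) : EReal))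
    {z : ℂ} (hz : z ∈ Ω) : u z ≤ (h z : EReal) := by
  by_contra! hlt
  obtain ⟨x, hx1, hx2⟩ := EReal.lt_iff_exists_real_btwn.1 hlt
  rw [EReal.coe_lt_coe_iff] at hx1
  set δ : ℝ := (x - h z) / 2 with hδ
  have hδ0 : 0 < δ := by rw [hδ]; linarith
  obtain ⟨K, hKΩ, hKc, hKu⟩ := hK δ hδ0
  have hzK : z ∈ K := by
    by_contra hn
    have := hx2.trans_le (hKu z hz hn)
    rw [EReal.coe_lt_coe_iff] at this
    linarith
  -- `u - h` is made strictly subharmonic by adding a small multiple of `|z| ^ 2`.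
  obtain ⟨B, hB⟩ := hKc.isBounded.exists_norm_le
  have hB0 : 0 ≤ B := (norm_nonneg z).trans (hB z hzK)
  set η : ℝ := δ / (B + 1) ^ 2 with hη
  have hη0 : 0 < η := by positivity
  have hηδ : η * (B + 1) ^ 2 = δ := by rw [hη]; field_simp
  set q : ℂ → ℝ := fun y => η * ‖y‖ ^ 2 - h y with hq
  have hqc : ContinuousOn q K :=
    (by fun_prop : Continuous fun y : ℂ => η * ‖y‖ ^ 2).continuousOn.sub
      (hh.continuousOn.mono hKΩ)
  have hwusc : UpperSemicontinuousOn (fun y => u y + (q y : EReal)) K := by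
    refine UpperSemicontinuousOn.add' (husc.upperSemicontinuousOn K) ?_ ?_
    · exact (continuous_coe_real_ereal.comp_continuousOn hqc).upperSemicontinuousOn
    · intro y _
      exact EReal.continuousAt_add (Or.inr (EReal.coe_ne_bot _)) (Or.inr (EReal.coe_ne_top _))
  obtain ⟨w, hwK, hwmax⟩ := hwusc.exists_isMaxOn ⟨z, hzK⟩ hKc
  have hwz := hwmax hzK
  simp only [mem_ofPred_eq] at hwz
  -- the value at the maximum point is finite and exceeds `2 δ`
  have hbig : ((2 * δ : ℝ) : EReal) < u w + (q w : EReal) := by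
    refine lt_of_lt_of_le ?_ hwz
    have : ((x + q z : ℝ) : EReal) < u z + (q z : EReal) := by
      rw [EReal.coe_add]
      exact EReal.add_lt_add_right_coe hx2 _
    refine lt_of_le_of_lt ?_ this
    rw [EReal.coe_le_coe_iff]
    have : 0 ≤ η * ‖z‖ ^ 2 := by positivity
    simp only [hq]
    linarith
  obtain ⟨m, hm⟩ : ∃ m : ℝ, u w = m := by
    refine ⟨(u w).toReal, (EReal.coe_toReal (htop w).ne ?_).symm⟩
    intro hb
    rw [hb, EReal.bot_add] at hbig
    exact not_lt_bot hbig
  rw [hm, ← EReal.coe_add, EReal.coe_lt_coe_iff] at hbig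
  obtain ⟨ε, hε, hεΩ⟩ := Metric.isOpen_iff.1 hΩ w (hKΩ hwK)
  have hmin : 0 < min ε 1 := lt_min hε one_pos
  obtain ⟨r, hrcomp, hr⟩ := ((hu w (hKΩ hwK)).and (Ioo_mem_nhdsGT hmin)).exists
  have hrΩ : closedBall w r ⊆ Ω :=
    (closedBall_subset_ball (hr.2.trans_le (min_le_left _ _))).trans hεΩ
  have hr1 : r < 1 := hr.2.trans_le (min_le_right _ _)
  have hr0 : 0 < r := hr.1
  -- On the circle `|y - w| = r` this affine function equals `|y| ^ 2`; at `w` it is larger.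
  set a : ℂ → ℝ := fun y => (2 * starRingEnd ℂ w * (y - w)).re + (‖w‖ ^ 2 + r ^ 2) with ha
  have haharm : ∀ y, HarmonicAt a y := fun y =>
    HarmonicAt.add (AnalyticAt.harmonicAt_re (f := fun y => 2 * starRingEnd ℂ w * (y - w))
      (by fun_prop)) (harmonicAt_const _)
  have hasph : ∀ y ∈ sphere w r, a y = ‖y‖ ^ 2 := by
    intro y hy
    have h1 : ‖y - w‖ ^ 2 = r ^ 2 := by rw [mem_sphere_iff_norm.1 hy]
    rw [Complex.sq_norm, Complex.normSq_apply] at h1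
    simp only [ha, Complex.sq_norm, Complex.normSq_apply]
    simp at h1 ⊢
    nlinarith
  have hcmp := hrcomp (fun y => h y + (m + q w) - η * a y) ?_ ?_
  · rw [hm, EReal.coe_le_coe_iff] at hcmp
    have : a w = ‖w‖ ^ 2 + r ^ 2 := by simp [ha]
    rw [this] at hcmp
    simp only [hq] at hcmp
    nlinarith [mul_pos hη0 (pow_pos hr0 2)]
  · intro y hy
    exact ((hh y (hrΩ hy)).add (harmonicAt_const _)).sub ((haharm y).const_smul (c := η))
  · intro y hy
    have hyΩ := hrΩ (sphere_subset_closedBall hy)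
    simp only [hasph y hy]
    by_cases hyK : y ∈ K
    · have h1 := hwmax hyK
      simp only [mem_ofPred_eq, hm] at h1
      rcases eq_or_ne (u y) ⊥ with hb | hb
      · rw [hb]; exact bot_le
      lift u y to ℝ using ⟨(htop y).ne, hb⟩ with v
      rw [← EReal.coe_add, ← EReal.coe_add, EReal.coe_le_coe_iff] at h1
      rw [EReal.coe_le_coe_iff]
      simp only [hq] at h1 ⊢
      linarith
    · refine (hKu y hyΩ hyK).trans ?_
      rw [EReal.coe_le_coe_iff]
      have hy1 : ‖y‖ ≤ B + 1 := by
        have := norm_le_norm_add_norm_sub' y w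
        have h2 := mem_sphere_iff_norm.1 hy
        have h3 := hB w hwK
        linarith
      have : η * ‖y‖ ^ 2 ≤ δ := by
        rw [← hηδ]; gcongr
      linarith

/-- The maximum principle on open discs turns the local comparison into the global one; continuity
at the boundary circle supplies the compact sets. -/
lemma isSubharmonic_of_locally {f : ℂ → ℝ} (hf : Continuous f)
    (hloc : ∀ z, LocallySubharmonicAt (fun y => (f y : EReal)) z) :
    IsSubharmonic (fun y => (f y : EReal)) := by
  have husc : UpperSemicontinuous (fun y => (f y : EReal)) :=
    (continuous_coe_real_ereal.comp hf).upperSemicontinuous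
  refine ⟨fun z => EReal.coe_lt_top _, husc, ?_⟩
  intro c r hr h hc hh hle z hz
  by_cases hzs : z ∈ sphere c r
  · exact hle z hzs
  have hzb : z ∈ ball c r := lt_of_le_of_ne hz hzs
  refine le_of_locallySubharmonicAt isOpen_ball (fun z => EReal.coe_lt_top _) husc
    (fun z _ => hloc z) hh ?_ hzb
  intro δ hδ
  refine ⟨closedBall c r ∩ (fun y => f y - h y) ⁻¹' Ici δ, ?_, ?_, ?_⟩
  · rintro y ⟨hy, hyδ⟩
    refine lt_of_le_of_ne (mem_closedBall.1 hy) fun hys => ?_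
    have := EReal.coe_le_coe_iff.1 (hle y hys)
    simp only [mem_preimage, mem_Ici] at hyδ
    linarith
  · exact (isCompact_closedBall c r).of_isClosed_subset
      ((hf.continuousOn.sub hc).preimage_isClosed_of_isClosed isClosed_closedBall isClosed_Ici)
      inter_subset_left
  · intro y hy hyn
    rw [EReal.coe_le_coe_iff]
    by_contra! hcon
    exact hyn ⟨ball_subset_closedBall hy, by simp only [mem_preimage, mem_Ici]; linarith⟩

/-! ### The ellipse and the cut -/

/-- The quadratic form whose unit sublevel set is `ellipse τ`. -/
noncomputable def ellipseForm (τ : ℝ) (z : ℂ) : ℝ := (z.re / (1 + τ)) ^ 2 + (z.im / (1 - τ)) ^ 2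

/-- The harmonic branch of `obstacleFormula`, considered on the whole complement of `cut τ`. -/
noncomputable def exteriorFormula (τ : ℝ) (z : ℂ) : ℝ :=
  2 * Real.log ‖psi τ z‖ + 1 + τ * (1 / psi τ z ^ 2).re

lemma mem_ellipse {τ : ℝ} {z : ℂ} : z ∈ ellipse τ ↔ ellipseForm τ z ≤ 1 := Iff.rfl

lemma mem_compl_ellipse {τ : ℝ} {z : ℂ} : z ∈ (ellipse τ)ᶜ ↔ 1 < ellipseForm τ z := by
  rw [mem_compl_iff, mem_ellipse, not_le]

@[fun_prop]
lemma continuous_ellipseForm (τ : ℝ) : Continuous (ellipseForm τ) := by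
  unfold ellipseForm; fun_prop

@[fun_prop]
lemma continuous_potential (τ : ℝ) : Continuous (potential τ) := by
  unfold potential; fun_prop

lemma isOpen_compl_ellipse (τ : ℝ) : IsOpen (ellipse τ)ᶜ := by
  have : (ellipse τ)ᶜ = {z | 1 < ellipseForm τ z} := by
    ext z; exact mem_compl_ellipse
  rw [this]
  exact isOpen_lt continuous_const (continuous_ellipseForm τ)

lemma isClosed_cut (τ : ℝ) : IsClosed (cut τ) :=
  (isClosed_eq Complex.continuous_im continuous_const).inter
    (isClosed_le (continuous_abs.comp Complex.continuous_re) continuous_const)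

lemma ne_zero_of_notMem_cut {τ : ℝ} {z : ℂ} (hz : z ∉ cut τ) : z ≠ 0 := by
  rintro rfl
  exact hz (by simp [cut])

/-! ### The inverse Joukowski map -/

lemma re_cpow_half_nonneg (x : ℂ) : 0 ≤ (x ^ (1 / 2 : ℂ)).re := by
  rcases eq_or_ne x 0 with rfl | hx
  · simp
  rw [Complex.cpow_def_of_ne_zero hx, Complex.exp_re]
  refine mul_nonneg (Real.exp_nonneg _) (Real.cos_nonneg_of_mem_Icc ?_)
  have h : (Complex.log x * (1 / 2)).im = x.arg / 2 := by
    rw [show (1 / 2 : ℂ) = ((1 / 2 : ℝ) : ℂ) by norm_num, Complex.im_mul_ofReal, Complex.log_im]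
    ring
  rw [h]
  constructor <;> linarith [Complex.neg_pi_lt_arg x, Complex.arg_le_pi x]

lemma norm_div_two_le_norm_psi (τ : ℝ) (z : ℂ) : ‖z‖ / 2 ≤ ‖psi τ z‖ := by
  set s : ℂ := (1 - 4 * (τ : ℂ) / z ^ 2) ^ (1 / 2 : ℂ) with hs
  have hre : 0 ≤ s.re := re_cpow_half_nonneg _
  have h : psi τ z = z / 2 * (1 + s) := by rw [psi, sqrtBranch, ← hs]; ring
  have h1 : 1 ≤ ‖1 + s‖ := by
    refine le_trans ?_ (Complex.re_le_norm _)
    simp [hre]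
  rw [h, norm_mul, norm_div, Complex.norm_ofNat]
  exact le_mul_of_one_le_right (by positivity) h1

lemma psi_ne_zero (τ : ℝ) {z : ℂ} (hz : z ≠ 0) : psi τ z ≠ 0 := by
  rw [← norm_pos_iff]
  exact (half_pos (norm_pos_iff.2 hz)).trans_le (norm_div_two_le_norm_psi τ z)

lemma psi_mul_sub (τ : ℝ) {z : ℂ} (hz : z ≠ 0) : psi τ z * (z - psi τ z) = τ := by
  have := sqrtBranch_sq τ hz
  unfold psi
  linear_combination -(1 / 4) * this

lemma psi_add_div (τ : ℝ) {z : ℂ} (hz : z ≠ 0) : psi τ z + τ / psi τ z = z := by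
  have h := psi_mul_sub τ hz
  have h0 := psi_ne_zero τ hz
  field_simp
  linear_combination -h

/-- Of the two roots of `w ^ 2 - z w + τ`, whose product is `τ`, the map `ψ` picks the larger one,
because the principal square root has nonnegative real part. -/
lemma le_norm_psi_sq {τ : ℝ} (hτ : 0 ≤ τ) {z : ℂ} (hz : z ≠ 0) : τ ≤ ‖psi τ z‖ ^ 2 := by
  set s : ℂ := (1 - 4 * (τ : ℂ) / z ^ 2) ^ (1 / 2 : ℂ) with hs
  have hre : 0 ≤ s.re := re_cpow_half_nonneg _
  have h : psi τ z = z / 2 * (1 + s) := by rw [psi, sqrtBranch, ← hs]; ring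
  have h' : z - psi τ z = z / 2 * (1 - s) := by rw [h]; ring
  have hle : ‖1 - s‖ ≤ ‖1 + s‖ := by
    rw [← sq_le_sq₀ (norm_nonneg _) (norm_nonneg _), Complex.sq_norm, Complex.sq_norm,
      Complex.normSq_apply, Complex.normSq_apply]
    simp
    nlinarith
  have h2 : ‖z - psi τ z‖ ≤ ‖psi τ z‖ := by
    rw [h', h, norm_mul, norm_mul]
    gcongr
  have h3 := congrArg norm (psi_mul_sub τ hz)
  rw [norm_mul, Complex.norm_real, Real.norm_of_nonneg hτ] at h3
  calc τ = ‖psi τ z‖ * ‖z - psi τ z‖ := h3.symm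
    _ ≤ ‖psi τ z‖ ^ 2 := by rw [sq]; gcongr

lemma joukowski_re (τ : ℝ) (w : ℂ) :
    (w + τ / w).re = w.re * (1 + τ / ‖w‖ ^ 2) := by
  rw [Complex.sq_norm]
  simp [Complex.div_re]
  ring

lemma joukowski_im (τ : ℝ) (w : ℂ) :
    (w + τ / w).im = w.im * (1 - τ / ‖w‖ ^ 2) := by
  rw [Complex.sq_norm]
  simp [Complex.div_im]
  ring

/-- The position of `w + τ / w` with respect to the ellipse is decided by the sign of
`‖w‖ ^ 2 - 1` as soon as `τ ^ 2 < ‖w‖ ^ 2`. -/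
lemma ellipseForm_joukowski {τ : ℝ} (hτ0 : 0 ≤ τ) (hτ1 : τ < 1) {w : ℂ} (hw : w ≠ 0) :
    ellipseForm τ (w + τ / w) - 1 =
      (‖w‖ ^ 2 - 1) * ((‖w‖ ^ 2 - τ ^ 2) / (‖w‖ ^ 2) ^ 2 *
        ((w.re / (1 + τ)) ^ 2 + (w.im / (1 - τ)) ^ 2)) := by
  have hs : ‖w‖ ^ 2 = w.re ^ 2 + w.im ^ 2 := by
    rw [Complex.sq_norm, Complex.normSq_apply]; ring
  have hs0 : ‖w‖ ^ 2 ≠ 0 := pow_ne_zero 2 (norm_ne_zero_iff.2 hw)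
  have h1 : 1 + τ ≠ 0 := by linarith
  have h2 : 1 - τ ≠ 0 := by linarith
  rw [ellipseForm, joukowski_re τ w, joukowski_im τ w]
  generalize ‖w‖ ^ 2 = s at *
  have h3 : (1 : ℝ) = (w.re ^ 2 + w.im ^ 2) / s := by rw [← hs, div_self hs0]
  calc _ = (w.re * (1 + τ / s) / (1 + τ)) ^ 2 + (w.im * (1 - τ / s) / (1 - τ)) ^ 2
        - (w.re ^ 2 + w.im ^ 2) / s := by rw [← h3]
    _ = _ := by field_simp; ring

/-- The positive factor multiplying `‖w‖ ^ 2 - 1` in `ellipseForm_joukowski`. -/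
lemma joukowski_factor_pos {τ : ℝ} (hτ0 : 0 ≤ τ) (hτ1 : τ < 1) {w : ℂ} (hw : w ≠ 0)
    (hle : τ ≤ ‖w‖ ^ 2) :
    0 < (‖w‖ ^ 2 - τ ^ 2) / (‖w‖ ^ 2) ^ 2 * ((w.re / (1 + τ)) ^ 2 + (w.im / (1 - τ)) ^ 2) := by
  have hs0 : 0 < ‖w‖ ^ 2 := pow_pos (norm_pos_iff.2 hw) 2
  have h1 : 0 < 1 + τ := by linarith
  have h2 : 0 < 1 - τ := by linarith
  refine mul_pos (div_pos ?_ (by positivity)) ?_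
  · rcases hτ0.eq_or_lt with rfl | h
    · simpa using hs0
    · nlinarith
  · by_cases hre : w.re = 0
    · have him : w.im ≠ 0 := fun him => hw (Complex.ext hre him)
      positivity
    · positivity

lemma one_lt_ellipseForm_joukowski {τ : ℝ} (hτ0 : 0 ≤ τ) (hτ1 : τ < 1) {w : ℂ} (hw : 1 < ‖w‖) :
    1 < ellipseForm τ (w + τ / w) := by
  have hw0 : w ≠ 0 := norm_pos_iff.1 (one_pos.trans hw)
  have h1 : 1 < ‖w‖ ^ 2 := one_lt_pow₀ hw two_ne_zero
  have := joukowski_factor_pos hτ0 hτ1 hw0 (by linarith)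
  have h2 := ellipseForm_joukowski hτ0 hτ1 hw0
  have := mul_pos (sub_pos.2 h1) this
  linarith

lemma one_lt_norm_psi_iff {τ : ℝ} (hτ0 : 0 ≤ τ) (hτ1 : τ < 1) {z : ℂ} (hz : z ≠ 0) :
    1 < ‖psi τ z‖ ↔ 1 < ellipseForm τ z := by
  have hw := psi_ne_zero τ hz
  have h := ellipseForm_joukowski hτ0 hτ1 hw
  rw [psi_add_div τ hz] at h
  rw [← one_lt_sq_iff₀ (norm_nonneg _), ← sub_pos, ← sub_pos (b := (1 : ℝ)), h]
  exact (mul_pos_iff_of_pos_right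
    (joukowski_factor_pos hτ0 hτ1 hw (le_norm_psi_sq hτ0 hz))).symm

lemma norm_psi_eq_one {τ : ℝ} (hτ0 : 0 ≤ τ) (hτ1 : τ < 1) {z : ℂ} (hz : z ≠ 0)
    (h1 : ellipseForm τ z = 1) : ‖psi τ z‖ = 1 := by
  have hw := psi_ne_zero τ hz
  have h := ellipseForm_joukowski hτ0 hτ1 hw
  rw [psi_add_div τ hz, h1, sub_self, eq_comm, mul_eq_zero,
    or_iff_left (joukowski_factor_pos hτ0 hτ1 hw (le_norm_psi_sq hτ0 hz)).ne'] at h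
  exact (pow_eq_one_iff_of_nonneg (norm_nonneg _) two_ne_zero).1 (sub_eq_zero.1 h)

lemma notMem_cut_of_one_le {τ : ℝ} (hτ0 : 0 ≤ τ) (hτ1 : τ < 1) {z : ℂ}
    (h : 1 ≤ ellipseForm τ z) : z ∉ cut τ := by
  rintro ⟨him, hre⟩
  have h1 : z.re ^ 2 ≤ 4 * τ := by
    have := pow_le_pow_left₀ (abs_nonneg _) hre 2
    rwa [sq_abs, mul_pow, Real.sq_sqrt hτ0, show (2 : ℝ) ^ 2 = 4 by norm_num] at this
  have h2 : ellipseForm τ z < 1 := by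
    rw [ellipseForm, him, div_pow, zero_div, zero_pow two_ne_zero, add_zero,
      div_lt_one (by positivity)]
    nlinarith [sq_pos_of_pos (sub_pos.2 hτ1)]
  linarith

lemma bijOn_psi {τ : ℝ} (hτ0 : 0 ≤ τ) (hτ1 : τ < 1) :
    BijOn (psi τ) (ellipse τ)ᶜ {w : ℂ | 1 < ‖w‖} := by
  have hne : ∀ z ∈ (ellipse τ)ᶜ, z ≠ 0 := fun z hz =>
    ne_zero_of_notMem_cut (notMem_cut_of_one_le hτ0 hτ1 (mem_compl_ellipse.1 hz).le)
  refine ⟨fun z hz => (one_lt_norm_psi_iff hτ0 hτ1 (hne z hz)).2 (mem_compl_ellipse.1 hz), ?_, ?_⟩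
  · intro z hz z' hz' h
    rw [← psi_add_div τ (hne z hz), ← psi_add_div τ (hne z' hz'), h]
  · intro w hw
    have hw1 : 1 < ‖w‖ := hw
    have hw0 : w ≠ 0 := norm_pos_iff.1 (one_pos.trans hw1)
    have hz := one_lt_ellipseForm_joukowski hτ0 hτ1 hw1
    have hz0 := hne _ (mem_compl_ellipse.2 hz)
    refine ⟨w + τ / w, mem_compl_ellipse.2 hz, ?_⟩
    have hpsi := (one_lt_norm_psi_iff hτ0 hτ1 hz0).2 hz
    have hroot := psi_mul_sub τ hz0
    set p := psi τ (w + τ / w)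
    -- `p` is one of the roots `w` and `τ / w`; the latter lies in the unit disc
    have hprod : (p - w) * (p * w - τ) = 0 := by
      have : τ / w * w = (τ : ℂ) := div_mul_cancel₀ _ hw0
      linear_combination (-w) * hroot + p * this
    rcases mul_eq_zero.1 hprod with h | h
    · exact sub_eq_zero.1 h
    · have := congrArg norm (sub_eq_zero.1 h)
      rw [norm_mul, Complex.norm_real, Real.norm_of_nonneg hτ0] at this
      nlinarith

lemma analyticAt_psi {τ : ℝ} (hτ0 : 0 ≤ τ) {z : ℂ} (hz : z ∉ cut τ) : AnalyticAt ℂ (psi τ) z := by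
  have hd : DifferentiableOn ℂ (psi τ) (cut τ)ᶜ :=
    (differentiableOn_id.add (differentiableOn_sqrtBranch hτ0)).div_const 2
  exact hd.analyticAt ((isClosed_cut τ).isOpen_compl.mem_nhds hz)

lemma harmonicAt_log_norm_psi {τ : ℝ} (hτ0 : 0 ≤ τ) {z : ℂ} (hz : z ∉ cut τ) :
    HarmonicAt (fun z => Real.log ‖psi τ z‖) z :=
  (analyticAt_psi hτ0 hz).harmonicAt_log_norm (psi_ne_zero τ (ne_zero_of_notMem_cut hz))

lemma harmonicAt_exteriorFormula {τ : ℝ} (hτ0 : 0 ≤ τ) {z : ℂ} (hz : z ∉ cut τ) :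
    HarmonicAt (exteriorFormula τ) z := by
  have h0 := psi_ne_zero τ (ne_zero_of_notMem_cut hz)
  have ha := analyticAt_psi hτ0 hz
  have h1 : AnalyticAt ℂ (fun z => 1 / psi τ z ^ 2) z :=
    analyticAt_const.div (ha.pow 2) (pow_ne_zero 2 h0)
  exact (((harmonicAt_log_norm_psi hτ0 hz).const_smul (c := (2 : ℝ))).add
    (harmonicAt_const 1)).add (h1.harmonicAt_re.const_smul (c := τ))

lemma continuousAt_exteriorFormula {τ : ℝ} (hτ0 : 0 ≤ τ) {z : ℂ} (hz : z ∉ cut τ) :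
    ContinuousAt (exteriorFormula τ) z :=
  (harmonicAt_exteriorFormula hτ0 hz).1.continuousAt

/-! ### The obstacle dominates the exterior formula -/

/-- For `τ = 1` this reads `log s ≤ sinh (log s)`, and for `τ = s` it is the Padé bound
`2 x / (x + 2) ≤ log (1 + x)` with `x = 1 / s - 1`. -/
lemma one_add_mul_log_le {τ s : ℝ} (hτ1 : τ ≤ 1) (hs : 0 < s) (hle : τ ≤ s) :
    (1 + τ) * Real.log s ≤ s - 1 + τ * (1 - 1 / s) := by
  -- the difference of the two sides decreases in `τ`, so only the largest `τ` matters
  have hdecr : 1 - 1 / s ≤ Real.log s := by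
    simpa using Real.one_sub_inv_le_log_of_pos hs
  rcases le_total 1 s with h1 | h1
  · have h2 : 2 * Real.log s ≤ s - 1 / s := by
      have := Real.self_le_sinh_iff.2 (Real.log_nonneg h1)
      rw [Real.sinh_log hs] at this
      rw [one_div]; linarith
    nlinarith
  · have h2 : (1 + s) * Real.log s ≤ 2 * (s - 1) := by
      have h3 := Real.le_log_one_add_of_nonneg (x := 1 / s - 1)
        (sub_nonneg.2 (by rw [one_div]; exact (one_le_inv₀ hs).2 h1))
      rw [show 1 + (1 / s - 1) = s⁻¹ by rw [one_div]; ring, Real.log_inv,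
        show 2 * (1 / s - 1) / (1 / s - 1 + 2) = 2 * (1 - s) / (1 + s) by field_simp; ring,
        div_le_iff₀ (by positivity)] at h3
      linarith
    have h4 : s * (1 - 1 / s) = s - 1 := by field_simp
    nlinarith [mul_nonneg (sub_nonneg.2 hle) (sub_nonneg.2 hdecr)]

lemma one_sub_mul_log_le {τ s : ℝ} (hτ0 : 0 ≤ τ) (hs : 0 < s) :
    (1 - τ) * Real.log s ≤ s - 1 - τ * (1 - 1 / s) := by
  have h1 : 1 - 1 / s ≤ Real.log s := by simpa using Real.one_sub_inv_le_log_of_pos hs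
  have h2 := Real.log_le_sub_one_of_pos hs
  nlinarith

/-- In the coordinate `w = ψ z` the gap `V - U` is a convex combination of two functions of
`‖w‖ ^ 2`. -/
lemma potential_sub_exteriorFormula {τ : ℝ} (hτ0 : 0 ≤ τ) (hτ1 : τ < 1) {z : ℂ} (hz : z ≠ 0) :
    let w := psi τ z
    let s := ‖w‖ ^ 2
    potential τ z - exteriorFormula τ z =
      w.re ^ 2 / s * ((s - 1 + τ * (1 - 1 / s)) / (1 + τ) - Real.log s) +
      w.im ^ 2 / s * ((s - 1 - τ * (1 - 1 / s)) / (1 - τ) - Real.log s) := by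
  intro w s
  have hw : w ≠ 0 := psi_ne_zero τ hz
  have hs : s = w.re ^ 2 + w.im ^ 2 := by
    simp only [s]
    rw [Complex.sq_norm, Complex.normSq_apply]; ring
  have hs0 : s ≠ 0 := pow_ne_zero 2 (norm_ne_zero_iff.2 hw)
  have h1 : 1 + τ ≠ 0 := by linarith
  have h2 : 1 - τ ≠ 0 := by linarith
  have hlog : 2 * Real.log ‖w‖ = Real.log s := by
    simp only [s]; rw [Real.log_pow]; norm_num
  have hre : (1 / w ^ 2).re = (w.re ^ 2 - w.im ^ 2) / s ^ 2 := by
    rw [one_div, Complex.inv_re, map_pow, Complex.normSq_eq_norm_sq]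
    congr 1
    simp [sq]
  have hV : potential τ z = (w.re * (1 + τ / s)) ^ 2 / (1 + τ)
      + (w.im * (1 - τ / s)) ^ 2 / (1 - τ) := by
    rw [← joukowski_re τ w, ← joukowski_im τ w, psi_add_div τ hz, potential]
  rw [hV, exteriorFormula, hlog, hre]
  clear_value s
  have h3 : w.im ^ 2 = s - w.re ^ 2 := by linarith
  simp only [mul_pow, h3]
  generalize Real.log s = l
  field_simp
  ring

lemma exteriorFormula_le_potential {τ : ℝ} (hτ0 : 0 ≤ τ) (hτ1 : τ < 1) {z : ℂ} (hz : z ≠ 0) :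
    exteriorFormula τ z ≤ potential τ z := by
  have h := potential_sub_exteriorFormula hτ0 hτ1 hz
  have hs : 0 < ‖psi τ z‖ ^ 2 := pow_pos (norm_pos_iff.2 (psi_ne_zero τ hz)) 2
  have h1 := one_add_mul_log_le hτ1.le hs (le_norm_psi_sq hτ0 hz)
  have h2 := one_sub_mul_log_le hτ0 hs
  rw [← sub_nonneg, h]
  refine add_nonneg (mul_nonneg (by positivity) (sub_nonneg.2 ?_))
    (mul_nonneg (by positivity) (sub_nonneg.2 ?_))
  · rw [le_div_iff₀ (by linarith)]; linarith
  · rw [le_div_iff₀ (by linarith)]; linarith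

lemma exteriorFormula_eq_potential {τ : ℝ} (hτ0 : 0 ≤ τ) (hτ1 : τ < 1) {z : ℂ} (hz : z ≠ 0)
    (h1 : ellipseForm τ z = 1) : exteriorFormula τ z = potential τ z := by
  have h := potential_sub_exteriorFormula hτ0 hτ1 hz
  simp only [norm_psi_eq_one hτ0 hτ1 hz h1] at h
  norm_num at h
  linarith

/-! ### The obstacle function -/

lemma obstacleFormula_of_le {τ : ℝ} {z : ℂ} (h : ellipseForm τ z ≤ 1) :
    obstacleFormula τ z = potential τ z := if_pos h

lemma obstacleFormula_of_lt {τ : ℝ} {z : ℂ} (h : 1 < ellipseForm τ z) :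
    obstacleFormula τ z = exteriorFormula τ z := if_neg (not_le.2 h)

lemma obstacleFormula_of_one_le {τ : ℝ} (hτ0 : 0 ≤ τ) (hτ1 : τ < 1) {z : ℂ}
    (h : 1 ≤ ellipseForm τ z) : obstacleFormula τ z = exteriorFormula τ z := by
  rcases h.eq_or_lt with h1 | h1
  · rw [obstacleFormula_of_le h1.ge, exteriorFormula_eq_potential hτ0 hτ1
      (ne_zero_of_notMem_cut (notMem_cut_of_one_le hτ0 hτ1 h)) h1.symm]
  · exact obstacleFormula_of_lt h1

lemma obstacleFormula_le_potential {τ : ℝ} (hτ0 : 0 ≤ τ) (hτ1 : τ < 1) (z : ℂ) :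
    obstacleFormula τ z ≤ potential τ z := by
  rcases le_or_gt (ellipseForm τ z) 1 with h | h
  · exact (obstacleFormula_of_le h).le
  · rw [obstacleFormula_of_lt h]
    exact exteriorFormula_le_potential hτ0 hτ1
      (ne_zero_of_notMem_cut (notMem_cut_of_one_le hτ0 hτ1 h.le))

lemma exteriorFormula_le_obstacleFormula {τ : ℝ} (hτ0 : 0 ≤ τ) (hτ1 : τ < 1) {z : ℂ}
    (hz : z ≠ 0) : exteriorFormula τ z ≤ obstacleFormula τ z := by
  rcases le_or_gt (ellipseForm τ z) 1 with h | h
  · rw [obstacleFormula_of_le h]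
    exact exteriorFormula_le_potential hτ0 hτ1 hz
  · exact (obstacleFormula_of_lt h).ge

lemma continuous_obstacleFormula {τ : ℝ} (hτ0 : 0 ≤ τ) (hτ1 : τ < 1) :
    Continuous (obstacleFormula τ) := by
  rw [continuous_iff_continuousAt]
  intro z
  rcases lt_or_ge (ellipseForm τ z) 1 with h | h
  · refine (continuous_potential τ).continuousAt.congr ?_
    filter_upwards [(continuous_ellipseForm τ).continuousAt.eventually_lt_const h] with y hy
    exact (obstacleFormula_of_le hy.le).symm
  have hc := continuousAt_exteriorFormula hτ0 (notMem_cut_of_one_le hτ0 hτ1 h)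
  rcases h.eq_or_lt with h1 | h1
  · have hV : Tendsto (potential τ) (𝓝 z) (𝓝 (obstacleFormula τ z)) := by
      rw [obstacleFormula_of_le h1.ge]
      exact (continuous_potential τ).continuousAt
    have hU : Tendsto (exteriorFormula τ) (𝓝 z) (𝓝 (obstacleFormula τ z)) := by
      rw [obstacleFormula_of_one_le hτ0 hτ1 h]
      exact hc
    classical
    exact (hV.if' (p := (· ∈ ellipse τ)) hU).congr fun y => rfl
  · refine hc.congr ?_
    filter_upwards [(continuous_ellipseForm τ).continuousAt.eventually_const_lt h1] with y hy
    exact (obstacleFormula_of_lt hy).symm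

/-- The potential is convex, so it lies above its tangent plane at `z`, which is harmonic. -/
lemma exists_harmonic_minorant_potential {τ : ℝ} (hτ0 : 0 ≤ τ) (hτ1 : τ < 1) (z : ℂ) :
    ∃ g : ℂ → ℝ, HarmonicAt g z ∧ (∀ y, g y ≤ potential τ y) ∧ potential τ z = g z := by
  let b : ℂ := ⟨2 * z.re / (1 + τ), -(2 * z.im / (1 - τ))⟩
  have ha : AnalyticAt ℂ (fun y : ℂ => b * (y - z)) z := by fun_prop
  refine ⟨fun y => (b * (y - z)).re + potential τ z, ha.harmonicAt_re.add (harmonicAt_const _),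
    fun y => ?_, by simp⟩
  have h1 : 0 < 1 + τ := by linarith
  have h2 : 0 < 1 - τ := by linarith
  have h : 0 ≤ (y.re - z.re) ^ 2 / (1 + τ) + (y.im - z.im) ^ 2 / (1 - τ) := by positivity
  rw [← sub_nonneg]
  convert h using 1
  simp only [potential, b, Complex.mul_re, Complex.sub_re, Complex.sub_im]
  ring

lemma locallySubharmonicAt_obstacleFormula {τ : ℝ} (hτ0 : 0 ≤ τ) (hτ1 : τ < 1) (z : ℂ) :
    LocallySubharmonicAt (fun y => (obstacleFormula τ y : EReal)) z := by
  rcases lt_or_ge (ellipseForm τ z) 1 with h | h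
  · obtain ⟨g, hg, hle, heq⟩ := exists_harmonic_minorant_potential hτ0 hτ1 z
    refine locallySubharmonicAt_of_minorant hg ?_ ?_
    · filter_upwards [(continuous_ellipseForm τ).continuousAt.eventually_lt_const h] with y hy
      rw [obstacleFormula_of_le hy.le]
      exact hle y
    · rw [obstacleFormula_of_le h.le, heq]
  · have hz := notMem_cut_of_one_le hτ0 hτ1 h
    refine locallySubharmonicAt_of_minorant (harmonicAt_exteriorFormula hτ0 hz) ?_
      (obstacleFormula_of_one_le hτ0 hτ1 h)
    filter_upwards [eventually_ne_nhds (ne_zero_of_notMem_cut hz)] with y hy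
    exact exteriorFormula_le_obstacleFormula hτ0 hτ1 hy

lemma one_lt_ellipseForm_of_two_le {τ : ℝ} (hτ0 : 0 ≤ τ) (hτ1 : τ < 1) {z : ℂ} (hz : 2 ≤ ‖z‖) :
    1 < ellipseForm τ z := by
  have h1 : 0 < 1 + τ := by linarith
  have h2 : 0 < 1 - τ := by linarith
  have hs : 4 ≤ z.re ^ 2 + z.im ^ 2 := by
    have := Complex.sq_norm z
    rw [Complex.normSq_apply] at this
    nlinarith
  have h3 : z.re ^ 2 / (1 + τ) ^ 2 + z.im ^ 2 / (1 + τ) ^ 2 ≤ ellipseForm τ z := by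
    rw [ellipseForm, div_pow, div_pow]
    gcongr ?_ + _ / (?_) ^ 2
    · exact le_rfl
    · linarith
  refine lt_of_lt_of_le ?_ h3
  rw [← add_div, one_lt_div (by positivity)]
  nlinarith

lemma abs_exteriorFormula_sub_log_le {τ : ℝ} (hτ0 : 0 ≤ τ) (hτ1 : τ < 1) {z : ℂ}
    (hz2 : 2 ≤ ‖z‖) :
    |exteriorFormula τ z - Real.log (‖z‖ ^ 2)| ≤ 2 * Real.log 2 + 2 := by
  have h := one_lt_ellipseForm_of_two_le hτ0 hτ1 hz2
  have hz : z ≠ 0 := ne_zero_of_notMem_cut (notMem_cut_of_one_le hτ0 hτ1 h.le)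
  have hp : 1 < ‖psi τ z‖ := (one_lt_norm_psi_iff hτ0 hτ1 hz).2 h
  have hp0 : 0 < ‖psi τ z‖ := one_pos.trans hp
  have hz0 : 0 < ‖z‖ := norm_pos_iff.2 hz
  have hle1 : Real.log ‖z‖ ≤ Real.log 2 + Real.log ‖psi τ z‖ := by
    rw [← Real.log_mul two_ne_zero hp0.ne']
    exact Real.log_le_log hz0 (by linarith [norm_div_two_le_norm_psi τ z])
  have hdiv : ‖(τ : ℂ) / psi τ z‖ ≤ τ := by
    rw [norm_div, Complex.norm_real, Real.norm_of_nonneg hτ0]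
    exact div_le_self hτ0 hp.le
  have hle2 : Real.log ‖psi τ z‖ ≤ Real.log 2 + Real.log ‖z‖ := by
    rw [← Real.log_mul two_ne_zero hz0.ne']
    refine Real.log_le_log hp0 ?_
    have h1 : psi τ z = z - τ / psi τ z := eq_sub_of_add_eq (psi_add_div τ hz)
    have h2 := norm_sub_le z (τ / psi τ z)
    rw [← h1] at h2
    linarith
  have hre : |τ * (1 / psi τ z ^ 2).re| ≤ 1 := by
    rw [abs_mul, abs_of_nonneg hτ0]
    have : |(1 / psi τ z ^ 2).re| ≤ 1 := by
      refine (Complex.abs_re_le_norm _).trans ?_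
      rw [norm_div, norm_one, norm_pow]
      exact div_le_one_of_le₀ (one_le_pow₀ hp.le) (by positivity)
    exact mul_le_one₀ hτ1.le (abs_nonneg _) this
  rw [exteriorFormula, Real.log_pow, abs_le]
  rw [abs_le] at hre
  push_cast
  constructor <;> linarith

lemma obstacleFormula_mem_obstacleClass {τ : ℝ} (hτ0 : 0 ≤ τ) (hτ1 : τ < 1) :
    (fun z => (obstacleFormula τ z : EReal)) ∈ obstacleClass (potential τ) := by
  refine ⟨isSubharmonic_of_locally (continuous_obstacleFormula hτ0 hτ1)
    (locallySubharmonicAt_obstacleFormula hτ0 hτ1),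
    fun z => EReal.coe_le_coe_iff.2 (obstacleFormula_le_potential hτ0 hτ1 z),
    2 * Real.log 2 + 2, 2, fun z hz => ?_⟩
  have h := one_lt_ellipseForm_of_two_le hτ0 hτ1 hz
  have habs := abs_le.1 (abs_exteriorFormula_sub_log_le hτ0 hτ1 hz)
  rw [EReal.coe_le_coe_iff, EReal.coe_le_coe_iff, obstacleFormula_of_lt h]
  constructor <;> linarith

/-- A competitor lies below `U + ε log ‖ψ‖` outside the ellipse: near the ellipse the obstacle
itself is close to `U`, and near infinity the logarithm absorbs the `O(1)` in the growth bound. -/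
lemma le_exteriorFormula_add {τ : ℝ} (hτ0 : 0 ≤ τ) (hτ1 : τ < 1) {u : ℂ → EReal}
    (hu : u ∈ obstacleClass (potential τ)) {ε : ℝ} (hε : 0 < ε) {z : ℂ} (hz : z ∈ (ellipse τ)ᶜ) :
    u z ≤ ((exteriorFormula τ z + ε * Real.log ‖psi τ z‖ : ℝ) : EReal) := by
  obtain ⟨hsub, hV, C, R, hgrowth⟩ := hu
  have hcut : ∀ y, 1 ≤ ellipseForm τ y → y ∉ cut τ := fun y => notMem_cut_of_one_le hτ0 hτ1
  refine le_of_locallySubharmonicAt (isOpen_compl_ellipse τ) hsub.lt_top hsub.upperSemicontinuous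
    (fun y _ => hsub.locallySubharmonicAt y)
    (h := fun y => exteriorFormula τ y + ε * Real.log ‖psi τ y‖) (fun y hy => ?_)
    (fun δ hδ => ?_) hz
  · have hy' := hcut y (mem_compl_ellipse.1 hy).le
    exact (harmonicAt_exteriorFormula hτ0 hy').add
      ((harmonicAt_log_norm_psi hτ0 hy').const_smul (c := ε))
  -- beyond this radius `ε log ‖ψ‖` exceeds the constants of both growth bounds
  set D : ℝ := (C + 2 * Real.log 2 + 2) / ε with hD
  set R' : ℝ := max (max R 2) (2 * Real.exp D) with hR'
  refine ⟨(closedBall 0 R' ∩ {y | 1 ≤ ellipseForm τ y}) ∩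
    (fun y => potential τ y - exteriorFormula τ y) ⁻¹' Ici δ, ?_, ?_, ?_⟩
  · rintro y ⟨⟨_, hy1⟩, hyδ⟩
    have hy1 : 1 ≤ ellipseForm τ y := hy1
    have hyδ : δ ≤ potential τ y - exteriorFormula τ y := hyδ
    refine mem_compl_ellipse.2 (lt_of_le_of_ne hy1 fun h => ?_)
    have := exteriorFormula_eq_potential hτ0 hτ1 (ne_zero_of_notMem_cut (hcut y hy1)) h.symm
    linarith
  · have hcl : IsClosed (closedBall (0 : ℂ) R' ∩ {y | 1 ≤ ellipseForm τ y}) :=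
      isClosed_closedBall.inter (isClosed_le continuous_const (continuous_ellipseForm τ))
    refine (isCompact_closedBall (0 : ℂ) R').of_isClosed_subset
      (ContinuousOn.preimage_isClosed_of_isClosed ?_ hcl isClosed_Ici)
      (inter_subset_left.trans inter_subset_left)
    intro y hy
    exact ((continuous_potential τ).continuousAt.sub
      (continuousAt_exteriorFormula hτ0 (hcut y hy.2))).continuousWithinAt
  · intro y hy hyK
    have hy1 := mem_compl_ellipse.1 hy
    have hp : 1 < ‖psi τ y‖ :=
      (one_lt_norm_psi_iff hτ0 hτ1 (ne_zero_of_notMem_cut (hcut y hy1.le))).2 hy1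
    have hlog : 0 < Real.log ‖psi τ y‖ := Real.log_pos hp
    by_cases hyR : ‖y‖ ≤ R'
    · refine (hV y).trans (EReal.coe_le_coe_iff.2 ?_)
      have : potential τ y - exteriorFormula τ y < δ := by
        by_contra! hcon
        exact hyK ⟨⟨by simpa using hyR, hy1.le⟩, hcon⟩
      have := mul_pos hε hlog
      linarith
    · rw [not_le] at hyR
      refine (hgrowth y (((le_max_left _ _).trans (le_max_left _ _)).trans hyR.le)).2.trans
        (EReal.coe_le_coe_iff.2 ?_)
      have habs := abs_le.1 (abs_exteriorFormula_sub_log_le hτ0 hτ1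
        (((le_max_right _ _).trans (le_max_left _ _)).trans hyR.le))
      have hDle : D ≤ Real.log ‖psi τ y‖ := by
        rw [Real.le_log_iff_exp_le (one_pos.trans hp)]
        have h1 := (le_max_right (max R 2) (2 * Real.exp D)).trans hyR.le
        linarith [norm_div_two_le_norm_psi τ y]
      have h2 : C + 2 * Real.log 2 + 2 ≤ ε * Real.log ‖psi τ y‖ := by
        rwa [hD, div_le_iff₀' hε] at hDle
      linarith

lemma le_obstacleFormula {τ : ℝ} (hτ0 : 0 ≤ τ) (hτ1 : τ < 1) {u : ℂ → EReal}
    (hu : u ∈ obstacleClass (potential τ)) (z : ℂ) : u z ≤ (obstacleFormula τ z : EReal) := by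
  by_cases hz : z ∈ ellipse τ
  · rw [obstacleFormula_of_le hz]
    exact hu.2.1 z
  rw [obstacleFormula_of_lt (mem_compl_ellipse.1 hz)]
  have hlim : Tendsto (fun ε : ℝ => ((exteriorFormula τ z + ε * Real.log ‖psi τ z‖ : ℝ) : EReal))
      (𝓝[>] 0) (𝓝 (exteriorFormula τ z : EReal)) := by
    refine (continuous_coe_real_ereal.tendsto _).comp (tendsto_nhdsWithin_of_tendsto_nhds ?_)
    have : Continuous fun ε : ℝ => exteriorFormula τ z + ε * Real.log ‖psi τ z‖ := by fun_prop
    simpa using this.tendsto 0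
  refine ge_of_tendsto hlim ?_
  filter_upwards [self_mem_nhdsWithin] with ε hε
  exact le_exteriorFormula_add hτ0 hτ1 hu hε hz

end EllipticGinibre

open EllipticGinibre in
theorem proposition5p1 (τ : ℝ) (hτ0 : 0 ≤ τ) (hτ1 : τ < 1) :
    (DifferentiableOn ℂ (psi τ) (ellipse τ)ᶜ ∧
      Set.BijOn (psi τ) (ellipse τ)ᶜ {w : ℂ | 1 < ‖w‖}) ∧
    IsObstacleFunction (potential τ) (obstacleFormula τ) := by
  refine ⟨⟨fun z hz => ?_, bijOn_psi hτ0 hτ1⟩,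
    obstacleFormula_mem_obstacleClass hτ0 hτ1, fun u hu z => le_obstacleFormula hτ0 hτ1 hu z⟩
  exact (analyticAt_psi hτ0 (notMem_cut_of_one_le hτ0 hτ1
    (mem_compl_ellipse.1 hz).le)).differentiableAt.differentiableWithinAt
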